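/- Let $p\ge 1$ be an integer, and let the Birkhoff polytope $B_p\subset\mathbb{R}^{p\times p}$ be the set of real $p\times p$ matrices with nonnegative entries all of whose row sums and column sums equal $1$. Let $A_p$ be the (finite) set of vertices of $B_p$. A triangulation of $B_p$ is a geometric simplicial complex $\mathcal{T}$ in $\mathbb{R}^{p\times p}$ (simplices closed under taking faces, any two intersecting in a common, possibly empty, face) all of whose vertices belong to $A_p$ and the union of whose simplices is $\operatorname{conv}(A_p)=B_p$. Given a lifting $w\colon A_p\to\mathbb{R}$, a lower face of $Q_w=\operatorname{conv}\{(a,w(a)) : a\in A_p\}\subset\mathbb{R}^{p\times p}\times\mathbb{R}$ is a nonempty face of $Q_w$ of the form $\{x\in Q_w : \xi(x)=\max_{Q_w}\xi\}$ for some linear functional $\xi$ whose last coefficient is negative. The triangulation $\mathcal{T}$ is regular if for some lifting $w$ the nonempty simplices of $\mathcal{T}$ are exactly the images of the lower faces of $Q_w$ under the projection $\mathbb{R}^{p\times p}\times\mathbb{R}\to\mathbb{R}^{p\times p}$. Theorem. If $p\ge 4$, then $B_p$ has a triangulation that is not regular. If $p<4$, then every triangulation of $B_p$ is regular. -/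

import Mathlib

/-- The Birkhoff polytope `B_p`: real `p × p` matrices with nonnegative entries all of whose row sums
and column sums equal `1`. -/
def birkhoffPolytope (p : ℕ) : Set (Matrix (Fin p) (Fin p) ℝ) :=
  (doublyStochastic ℝ (Fin p) : Set (Matrix (Fin p) (Fin p) ℝ))

/-- The vertices of the Birkhoff polytope. -/
def birkhoffVertices (p : ℕ) : Set (Matrix (Fin p) (Fin p) ℝ) :=
  Set.extremePoints ℝ (birkhoffPolytope p)

section

variable {E : Type*} [AddCommGroup E] [Module ℝ E]

/-- A triangulation of a point configuration `A`: a geometric simplicial complex (recorded by the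
vertex sets of its nonempty simplices) all of whose vertices belong to `A` and whose simplices
cover `conv A`. -/
structure IsTriangulation (A : Set E) (T : Geometry.SimplicialComplex ℝ E) : Prop where
  vertices_subset : T.vertices ⊆ A
  space_eq : T.space = convexHull ℝ A

/-- The polytope `conv {(a, w a) | a ∈ A}`. Only the values of `w` on `A` matter. -/
def liftedPolytope (A : Set E) (w : E → ℝ) : Set (E × ℝ) :=
  convexHull ℝ ((fun a => (a, w a)) '' A)

/-- `F` is a lower face of `Q ⊆ E × ℝ`: a nonempty face on which a linear functional whose last
coefficient is negative (an outward normal pointing downwards) attains its maximum over `Q`. -/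
def IsLowerFace (Q F : Set (E × ℝ)) : Prop :=
  F.Nonempty ∧ ∃ ξ : E × ℝ →ₗ[ℝ] ℝ, ξ (0, 1) < 0 ∧ F = {x ∈ Q | ∀ y ∈ Q, ξ y ≤ ξ x}

/-- `T` is regular: for some lifting `w` of `A`, the simplices of `T` are exactly the projections of
the lower faces of the lifted polytope. -/
def IsRegularTriangulation (A : Set E) (T : Geometry.SimplicialComplex ℝ E) : Prop :=
  IsTriangulation A T ∧ ∃ w : E → ℝ,
    {σ : Set E | ∃ s ∈ T.faces, σ = convexHull ℝ (s : Set E)} =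
      {σ : Set E | ∃ F, IsLowerFace (liftedPolytope A w) F ∧ σ = Prod.fst '' F}

end

/-!
For `p < 4` the permutation matrices have, up to scaling, at most one affine dependence `z`: none
for `p ≤ 2`, and the sign of the permutation for `p = 3`. Any triangulation of such a configuration
is regular (`isRegularTriangulation_of_corank_le_one`). Indeed the positive and the negative part of
the dependence cannot both be simplices, since they are disjoint and their convex hulls meet. If,
say, the negative part is not a simplex, the simplices are exactly the nonempty sets not containing
it, and lifting the negative points to height `1` induces this triangulation.

For `p ≥ 4`, a non-regular triangulation is built by pulling vertices in a non-transitive way. A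
face of the Birkhoff polytope is the set of matrices with a prescribed support. Let `r` be an
asymmetric relation on permutations such that every face has a winner, a vertex beating all its
other vertices. Subtracting from a matrix the largest possible multiple of the winner of its
support, and iterating, decomposes it canonically as a combination of permutation matrices; the
supports of these decompositions form a triangulation (`pulledTriangulation`). Transitivity of `r`
is not needed. Take for `r` a linear order starting with `1 ≻ a ≻ b ≻ c`, where `a = (0 2)`,
`b = (1 2)`, `c = (0 1)`, except that `c` beats `a`. Every face still has a winner, because a face
containing `a`, `b` and `c` contains the identity. There are edges `{x, x'}`, `{y, y'}`, `{z, z'}`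
of the polytope with
`b + x + x' = c + y + y'`, `a + y + y' = b + z + z'` and `c + z + z' = a + x + x'`,
and the left-hand sides are simplices of the triangulation by the three comparisons of the cycle.
If the triangulation were regular, each equality would be a strict inequality between the heights,
and the sum of the three inequalities is absurd.
-/

section

open Finset

/-! ### Regularity of triangulations of point configurations -/

section CorankOne

variable {E : Type*} [AddCommGroup E] [Module ℝ E] {ι : Type*} [Fintype ι]

theorem mem_convexHull_image_iff_exists_weights (P : ι → E) (τ : Set ι) (x : E) :
    x ∈ convexHull ℝ (P '' τ) ↔ ∃ c : ι → ℝ, (∀ i, 0 ≤ c i) ∧ (∀ i, i ∉ τ → c i = 0) ∧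
      ∑ i, c i = 1 ∧ ∑ i, c i • P i = x := by
  classical
  constructor
  · let C : Set E := {x | ∃ c : ι → ℝ, (∀ i, 0 ≤ c i) ∧ (∀ i, i ∉ τ → c i = 0) ∧
      ∑ i, c i = 1 ∧ ∑ i, c i • P i = x}
    suffices h : convexHull ℝ (P '' τ) ⊆ C from fun hx => h hx
    refine convexHull_min ?_ ?_
    · rintro _ ⟨i, hi, rfl⟩
      refine ⟨Pi.single i 1, fun j => ?_, fun j hj => ?_, by simp, ?_⟩
      · by_cases h : j = i
        · subst h; simp
        · simp [h]
      · exact Pi.single_eq_of_ne (by rintro rfl; exact hj hi) _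
      · rw [Finset.sum_eq_single i] <;> simp +contextual
    · rintro _ ⟨c, hc0, hcτ, hc1, rfl⟩ _ ⟨d, hd0, hdτ, hd1, rfl⟩ s t hs ht hst
      refine ⟨fun i => s * c i + t * d i, fun i => ?_, fun i hi => ?_, ?_, ?_⟩
      · have := hc0 i; have := hd0 i; positivity
      · simp [hcτ i hi, hdτ i hi]
      · rw [sum_add_distrib, ← mul_sum, ← mul_sum, hc1, hd1]; simpa using hst
      · simp [add_smul, sum_add_distrib, smul_sum, mul_smul]
  · rintro ⟨c, hc0, hcτ, hc1, rfl⟩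
    have hsub : ∀ i, i ∉ univ.filter (fun i => i ∈ τ) → c i = 0 := by simpa using hcτ
    rw [← sum_subset (subset_univ (univ.filter (fun i => i ∈ τ)))
      (fun i _ hi => by rw [hsub i hi, zero_smul])]
    rw [← sum_subset (subset_univ (univ.filter (fun i => i ∈ τ))) (fun i _ hi => hsub i hi)] at hc1
    exact (convex_convexHull ℝ _).sum_mem (fun i _ => hc0 i) hc1
      (fun i hi => subset_convexHull ℝ _ ⟨i, by simpa using hi, rfl⟩)

/-- Linear duality for point configurations: a function on the points is the restriction of an
affine function as soon as it is orthogonal to all affine dependences. -/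
theorem exists_affine_extension (P : ι → E) (h : ι → ℝ)
    (hh : ∀ d : ι → ℝ, ∑ i, d i = 0 → ∑ i, d i • P i = 0 → ∑ i, d i * h i = 0) :
    ∃ (ℓ : E →ₗ[ℝ] ℝ) (c : ℝ), ∀ i, ℓ (P i) + c = h i := by
  classical
  let L : (E →ₗ[ℝ] ℝ) × ℝ →ₗ[ℝ] (ι → ℝ) :=
    { toFun := fun q i => q.1 (P i) + q.2
      map_add' := fun q q' => by ext i; simp; ring
      map_smul' := fun a q => by ext i; simp; ring }
  by_contra hcon
  have hmem : h ∉ LinearMap.range L := by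
    rintro ⟨q, hq⟩
    exact hcon ⟨q.1, q.2, fun i => congrFun hq i⟩
  obtain ⟨f, hfh, hf⟩ := Submodule.exists_le_ker_of_notMem hmem
  have hfsum : ∀ v : ι → ℝ, f v = ∑ i, f (Pi.single i 1) * v i := fun v => by
    conv_lhs => rw [pi_eq_sum_univ' v, map_sum]
    refine sum_congr rfl fun i _ => ?_
    rw [map_smul, smul_eq_mul, mul_comm]
  have hL : ∀ q, ∑ i, f (Pi.single i 1) * L q i = 0 := fun q => by
    rw [← hfsum]; exact hf ⟨q, rfl⟩
  refine hfh ?_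
  rw [hfsum]
  refine hh _ (by simpa [L] using hL (0, 1)) ?_
  rw [← Module.forall_dual_apply_eq_zero_iff ℝ]
  intro φ
  simpa [L, map_sum] using hL (φ, 0)

/-- The projection of the face of a lifted configuration on which `ξ` is maximal is the convex hull
of the points whose lifts maximize `ξ`. -/
theorem image_fst_maximal_face (P : ι → E) (w : E → ℝ) (ξ : E × ℝ →ₗ[ℝ] ℝ) (m : ℝ)
    (hm : ∀ i, ξ (P i, w (P i)) ≤ m) (hne : ∃ i, ξ (P i, w (P i)) = m) :
    Prod.fst '' {x ∈ liftedPolytope (Set.range P) w |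
        ∀ y ∈ liftedPolytope (Set.range P) w, ξ y ≤ ξ x} =
      convexHull ℝ (P '' {i | ξ (P i, w (P i)) = m}) := by
  set L : ι → E × ℝ := fun i => (P i, w (P i)) with hLdef
  have hQ : liftedPolytope (Set.range P) w = convexHull ℝ (L '' Set.univ) := by
    rw [liftedPolytope, ← Set.range_comp, Set.image_univ]; rfl
  obtain ⟨i₀, hi₀⟩ := hne
  rw [hQ]
  have hle : ∀ y ∈ convexHull ℝ (L '' Set.univ), ξ y ≤ m := by
    intro y hy
    obtain ⟨c, hc0, -, hc1, rfl⟩ := (mem_convexHull_image_iff_exists_weights _ _ _).1 hy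
    rw [map_sum]
    calc ∑ i, ξ (c i • L i) ≤ ∑ i, c i * m := by
          refine sum_le_sum fun i _ => ?_
          rw [map_smul, smul_eq_mul]
          exact mul_le_mul_of_nonneg_left (hm i) (hc0 i)
      _ = m := by rw [← sum_mul, hc1, one_mul]
  ext x
  constructor
  · rintro ⟨y, ⟨hy, hmax⟩, rfl⟩
    obtain ⟨c, hc0, -, hc1, rfl⟩ := (mem_convexHull_image_iff_exists_weights _ _ _).1 hy
    have hge : m ≤ ξ (∑ i, c i • L i) := by
      rw [← hi₀]
      exact hmax _ (subset_convexHull ℝ _ ⟨i₀, trivial, rfl⟩)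
    have hsum : ∑ i, c i * (m - ξ (L i)) = 0 := by
      refine le_antisymm ?_ (sum_nonneg fun i _ => mul_nonneg (hc0 i) (sub_nonneg.2 (hm i)))
      simp only [mul_sub, sum_sub_distrib, ← sum_mul, hc1, one_mul]
      simp only [map_sum, map_smul, smul_eq_mul] at hge
      linarith
    rw [sum_eq_zero_iff_of_nonneg
      (fun i _ => mul_nonneg (hc0 i) (sub_nonneg.2 (hm i)))] at hsum
    refine (mem_convexHull_image_iff_exists_weights _ _ _).2 ⟨c, hc0, fun i hi => ?_, hc1, ?_⟩
    · rcases mul_eq_zero.1 (hsum i (mem_univ i)) with h | h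
      · exact h
      · exact absurd (sub_eq_zero.1 h).symm hi
    · simp [hLdef, Prod.fst_sum]
  · intro hx
    obtain ⟨c, hc0, hcτ, hc1, rfl⟩ := (mem_convexHull_image_iff_exists_weights _ _ _).1 hx
    refine ⟨∑ i, c i • L i, ⟨?_, fun y hy => (hle y hy).trans ?_⟩, by simp [hLdef, Prod.fst_sum]⟩
    · exact (mem_convexHull_image_iff_exists_weights _ _ _).2 ⟨c, hc0, by simp, hc1, rfl⟩
    · rw [map_sum]
      have : ∀ i, ξ (c i • L i) = c i * m := fun i => by
        rw [map_smul, smul_eq_mul]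
        by_cases hi : ξ (L i) = m
        · rw [hi]
        · rw [hcτ i hi, zero_mul, zero_mul]
      simp only [this, ← sum_mul, hc1, one_mul, le_refl]

theorem exists_map_eq_of_mem_faces (P : ι ↪ E) (T : Geometry.SimplicialComplex ℝ E)
    (hT : IsTriangulation (Set.range P) T) {s : Finset E} (hs : s ∈ T.faces) :
    ∃ σ : Finset ι, σ.map P = s := by
  classical
  have hsP : (s : Set E) ⊆ Set.range P := by
    refine Set.Subset.trans ?_ hT.vertices_subset
    rw [T.vertices_eq]
    exact Set.subset_biUnion_of_mem (u := fun k : Finset E => (k : Set E)) hs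
  refine ⟨univ.filter (fun i => P i ∈ s), ?_⟩
  ext x
  simp only [mem_map, mem_filter, mem_univ, true_and]
  constructor
  · rintro ⟨i, hi, rfl⟩; exact hi
  · intro hx
    obtain ⟨i, rfl⟩ := hsP hx
    exact ⟨i, hx, rfl⟩

/-- A triangulation whose simplices are the zero sets of the nonnegative functions `w - h`, where
`h` runs over the affine functions, is regular. -/
theorem isRegularTriangulation_of_zero_sets (P : ι ↪ E) (T : Geometry.SimplicialComplex ℝ E)
    (hT : IsTriangulation (Set.range P) T) (w : ι → ℝ)
    (hface : ∀ σ : Finset ι, σ.map P ∈ T.faces → ∃ (ℓ : E →ₗ[ℝ] ℝ) (c : ℝ),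
      (∀ i, ℓ (P i) + c ≤ w i) ∧ ∀ i, ℓ (P i) + c = w i ↔ i ∈ σ)
    (hzero : ∀ σ : Finset ι, σ.Nonempty → ∀ (ℓ : E →ₗ[ℝ] ℝ) (c : ℝ),
      (∀ i, ℓ (P i) + c ≤ w i) → (∀ i, ℓ (P i) + c = w i ↔ i ∈ σ) → σ.map P ∈ T.faces) :
    IsRegularTriangulation (Set.range P) T := by
  classical
  refine ⟨hT, Function.extend P w 0, ?_⟩
  have hw : ∀ i, Function.extend P w 0 (P i) = w i := fun i => P.injective.extend_apply _ _ i
  ext S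
  constructor
  · rintro ⟨s, hs, rfl⟩
    obtain ⟨σ, rfl⟩ := exists_map_eq_of_mem_faces P T hT hs
    obtain ⟨i₀, hi₀⟩ : σ.Nonempty := by simpa using T.nonempty_of_mem_faces hs
    obtain ⟨ℓ, c, hle, heq⟩ := hface σ hs
    let ξ : E × ℝ →ₗ[ℝ] ℝ := ℓ.comp (LinearMap.fst ℝ E ℝ) - LinearMap.snd ℝ E ℝ
    have hξ : ∀ i, ξ (P i, Function.extend P w 0 (P i)) = ℓ (P i) - w i := fun i => by
      simp [ξ, hw]
    have key := image_fst_maximal_face P (Function.extend P w 0) ξ (-c)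
      (fun i => by rw [hξ]; linarith [hle i]) ⟨i₀, by rw [hξ]; linarith [(heq i₀).2 hi₀]⟩
    have hset : {i | ξ (P i, Function.extend P w 0 (P i)) = -c} = (σ : Set ι) := by
      ext i
      rw [Set.mem_ofPred_eq, hξ, mem_coe, ← heq]
      constructor <;> intro h <;> linarith
    rw [hset, ← coe_map] at key
    refine ⟨_, ⟨?_, ξ, by simp [ξ], rfl⟩, key.symm⟩
    have : (convexHull ℝ ((σ.map P : Finset E) : Set E)).Nonempty :=
      ⟨P i₀, subset_convexHull ℝ _ (by simpa using hi₀)⟩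
    rw [← key] at this
    exact this.of_image
  · rintro ⟨F, ⟨⟨x₀, hx₀⟩, ξ, hξneg, rfl⟩, rfl⟩
    have hne : Nonempty ι := by
      by_contra hemp
      rw [not_nonempty_iff] at hemp
      have := hx₀.1
      rw [liftedPolytope, Set.range_eq_empty, Set.image_empty, convexHull_empty] at this
      exact this
    obtain ⟨i₀, -, hi₀⟩ := exists_max_image univ
      (fun i => ξ (P i, Function.extend P w 0 (P i))) univ_nonempty
    set m := ξ (P i₀, Function.extend P w 0 (P i₀)) with hm
    have key := image_fst_maximal_face P (Function.extend P w 0) ξ m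
      (fun i => hi₀ i (mem_univ i)) ⟨i₀, rfl⟩
    have hset : {i | ξ (P i, Function.extend P w 0 (P i)) = m} =
        ((univ.filter fun i => ξ (P i, Function.extend P w 0 (P i)) = m : Finset ι) : Set ι) := by
      simp
    set σ : Finset ι := univ.filter fun i => ξ (P i, Function.extend P w 0 (P i)) = m with hσ
    rw [key, hset, ← coe_map]
    refine ⟨σ.map P, ?_, rfl⟩
    have hsplit : ∀ i, ξ (P i, Function.extend P w 0 (P i)) =
        ξ.comp (LinearMap.inl ℝ E ℝ) (P i) + w i * ξ (0, 1) := fun i => by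
      have : ((P i, w i) : E × ℝ) = (P i, 0) + w i • ((0 : E), (1 : ℝ)) := by simp
      rw [hw, this, map_add, map_smul, smul_eq_mul]
      simp
    -- dividing `ξ` by its last coefficient turns it into an affine function below `w`
    refine hzero σ ⟨i₀, by simp [hσ, hm]⟩ ((-(ξ (0, 1)))⁻¹ • ξ.comp (LinearMap.inl ℝ E ℝ))
      ((ξ (0, 1))⁻¹ * m) (fun i => ?_) (fun i => ?_)
    · have h1 := hi₀ i (mem_univ i)
      rw [hsplit] at h1
      rw [LinearMap.smul_apply, smul_eq_mul, ← sub_nonneg]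
      have h2 := div_nonneg_of_nonpos (sub_nonpos.2 h1) hξneg.le
      have h0 : ξ (0, 1) ≠ 0 := hξneg.ne
      refine h2.trans_eq ?_
      generalize ξ.comp (LinearMap.inl ℝ E ℝ) (P i) = u
      field_simp
      ring
    · have h0 : ξ (0, 1) ≠ 0 := hξneg.ne
      rw [hσ, mem_filter, hsplit, LinearMap.smul_apply, smul_eq_mul]
      simp only [mem_univ, true_and]
      generalize ξ.comp (LinearMap.inl ℝ E ℝ) (P i) = u
      constructor
      · intro h
        field_simp at h
        linarith
      · intro h
        field_simp
        linarith


/-! ### Configurations with at most one affine dependence -/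

/-- A convex combination of the points can be rewritten on the vertices of a simplex. -/
theorem exists_face_weights (P : ι ↪ E) (T : Geometry.SimplicialComplex ℝ E)
    (hT : IsTriangulation (Set.range P) T) (a : ι → ℝ) (ha0 : ∀ i, 0 ≤ a i) (ha1 : ∑ i, a i = 1) :
    ∃ σ : Finset ι, σ.map P ∈ T.faces ∧ ∃ c : ι → ℝ, (∀ i, 0 ≤ c i) ∧ (∀ i, i ∉ σ → c i = 0) ∧
      ∑ i, c i = 1 ∧ ∑ i, c i • P i = ∑ i, a i • P i := by
  have hx : ∑ i, a i • P i ∈ T.space := by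
    rw [hT.space_eq, ← Set.image_univ]
    exact (mem_convexHull_image_iff_exists_weights _ _ _).2 ⟨a, ha0, by simp, ha1, rfl⟩
  obtain ⟨s, hs, hxs⟩ := T.mem_space_iff.1 hx
  obtain ⟨σ, rfl⟩ := exists_map_eq_of_mem_faces P T hT hs
  rw [coe_map] at hxs
  obtain ⟨c, hc⟩ := (mem_convexHull_image_iff_exists_weights _ _ _).1 hxs
  exact ⟨σ, hs, c, by simpa using hc⟩

variable (P : ι ↪ E) (z : ι → ℝ) (hz0 : ∑ i, z i = 0) (hzP : ∑ i, z i • P i = 0)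
  (hdep : ∀ d : ι → ℝ, ∑ i, d i = 0 → ∑ i, d i • P i = 0 → ∃ t, ∀ i, d i = t * z i)
  (T : Geometry.SimplicialComplex ℝ E) (hT : IsTriangulation (Set.range P) T)

include hdep hT in
/-- If no simplex contains all points with negative coefficient in the circuit `z`, then every
point set with this property is a simplex: its barycenter lies in some simplex, and two convex
combinations of a point that both omit a point with negative coefficient coincide. -/
theorem map_mem_faces_of_circuit
    (hsep : ∀ σ : Finset ι, σ.map P ∈ T.faces → z = 0 ∨ ∃ j, z j < 0 ∧ j ∉ σ)
    (τ : Finset ι) (hne : τ.Nonempty) (hτ : z = 0 ∨ ∃ j, z j < 0 ∧ j ∉ τ) :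
    τ.map P ∈ T.faces := by
  classical
  have hcard : (0 : ℝ) < #τ := by exact_mod_cast hne.card_pos
  obtain ⟨σ, hσ, c, hc0, hcσ, hc1, hcP⟩ := exists_face_weights P T hT
    (fun i => if i ∈ τ then (#τ : ℝ)⁻¹ else 0) (fun i => by split_ifs <;> positivity)
    (by rw [← sum_filter, sum_const]; simp [hcard.ne'])
  obtain ⟨t, ht⟩ := hdep (fun i => (if i ∈ τ then (#τ : ℝ)⁻¹ else 0) - c i)
    (by rw [sum_sub_distrib, hc1, ← sum_filter, sum_const]; simp [hcard.ne'])
    (by simp only [sub_smul, sum_sub_distrib, hcP, sub_self])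
  have htz : ∀ i, t * z i = 0 := by
    rcases hτ with rfl | ⟨i, hi, hiτ⟩
    · simp
    rcases hsep σ hσ with rfl | ⟨j, hj, hjσ⟩
    · simp
    have h1 := ht i
    have h2 := ht j
    simp only [hiτ, if_false] at h1
    simp only [hcσ j hjσ] at h2
    have h3 : 0 ≤ t := by
      by_contra h; push Not at h
      have := mul_pos_of_neg_of_neg h hi
      linarith [hc0 i]
    have h4 : t ≤ 0 := by
      by_contra h; push Not at h
      have := mul_neg_of_pos_of_neg h hj
      have : (0 : ℝ) ≤ if j ∈ τ then (#τ : ℝ)⁻¹ else 0 := by split_ifs <;> positivity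
      linarith
    simp [le_antisymm h4 h3]
  refine T.down_closed hσ ?_ (by simpa using hne)
  rw [map_subset_map]
  intro i hi
  by_contra hiσ
  have := ht i
  rw [htz, if_pos hi, hcσ i hiσ, sub_zero, inv_eq_zero] at this
  exact hcard.ne' this

include hz0 hzP hdep hT in
/-- If the simplices are the point sets omitting a point with negative coefficient in the circuit
`z`, then lifting exactly the points with negative coefficient induces the triangulation. -/
theorem isRegularTriangulation_of_faces_circuit
    (hfaces : ∀ σ : Finset ι, σ.map P ∈ T.faces ↔ σ.Nonempty ∧ (z = 0 ∨ ∃ j, z j < 0 ∧ j ∉ σ)) :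
    IsRegularTriangulation (Set.range P) T := by
  classical
  set w : ι → ℝ := fun i => if z i < 0 then 1 else 0 with hw
  have hzw : ∑ i, z i * w i = ∑ i with z i < 0, z i := by
    rw [sum_filter]
    exact sum_congr rfl fun i _ => by simp only [hw]; split_ifs <;> simp
  have hzaff : ∀ (ℓ : E →ₗ[ℝ] ℝ) (c : ℝ), ∑ i, z i * (ℓ (P i) + c) = 0 := fun ℓ c => by
    have := congrArg ℓ hzP
    simp only [map_sum, map_smul, smul_eq_mul, map_zero] at this
    simp only [mul_add, sum_add_distrib, this, ← sum_mul, hz0, zero_mul, add_zero]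
  refine isRegularTriangulation_of_zero_sets P T hT w (fun σ hσ => ?_)
    (fun σ hne ℓ c hle heq => (hfaces σ).2 ⟨hne, ?_⟩)
  · -- the height `g` above the affine function vanishes exactly on `σ`, is `1` at the remaining
    -- points with `0 ≤ z`, and has a constant value `V` at the remaining negative points that
    -- makes `w - g` orthogonal to `z`
    obtain ⟨hne, hσ⟩ := (hfaces σ).1 hσ
    obtain ⟨g, hg0, hgσ, hzg⟩ : ∃ g : ι → ℝ, (∀ i, 0 ≤ g i) ∧ (∀ i, g i = 0 ↔ i ∈ σ) ∧
        ∑ i, z i * g i = ∑ i, z i * w i := by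
      rcases hσ with rfl | ⟨j, hj, hjσ⟩
      · exact ⟨fun i => if i ∈ σ then 0 else 1, fun i => by dsimp only; split_ifs <;> simp,
          fun i => by simp, by simp⟩
      set N : ℝ := ∑ i with z i < 0 ∧ i ∉ σ, z i with hN
      set M : ℝ := ∑ i with ¬ z i < 0 ∧ i ∉ σ, z i with hM
      have hNneg : N < 0 := sum_neg (fun i hi => (mem_filter.1 hi).2.1) ⟨j, by simp [hj, hjσ]⟩
      have hMnn : 0 ≤ M := sum_nonneg fun i hi => not_lt.1 (mem_filter.1 hi).2.1
      have hWneg : ∑ i, z i * w i < 0 := by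
        rw [hzw]
        exact sum_neg (fun i hi => (mem_filter.1 hi).2) ⟨j, by simp [hj]⟩
      set V : ℝ := (∑ i, z i * w i - M) / N with hV
      have hVpos : 0 < V := div_pos_of_neg_of_neg (by linarith) hNneg
      refine ⟨fun i => if i ∈ σ then 0 else if z i < 0 then V else 1, fun i => ?_, fun i => ?_, ?_⟩
      · dsimp only; split_ifs <;> linarith
      · by_cases h1 : i ∈ σ <;> by_cases h2 : z i < 0 <;> simp [h1, h2, hVpos.ne']
      · have : ∀ i, z i * (if i ∈ σ then 0 else if z i < 0 then V else 1) =
            (if z i < 0 ∧ i ∉ σ then z i else 0) * V + if ¬ z i < 0 ∧ i ∉ σ then z i else 0 := by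
          intro i
          by_cases h1 : i ∈ σ <;> by_cases h2 : z i < 0 <;> simp [h1, h2]
        simp only [this, sum_add_distrib, ← sum_mul, ← sum_filter]
        rw [← hN, ← hM, hV, mul_div_cancel₀ _ hNneg.ne, sub_add_cancel]
    obtain ⟨ℓ, c, hℓ⟩ := exists_affine_extension P (fun i => w i - g i) (fun d hd0 hdP => by
      obtain ⟨t, ht⟩ := hdep d hd0 hdP
      simp only [ht, mul_sub, mul_assoc, sum_sub_distrib, ← mul_sum, hzg, sub_self])
    refine ⟨ℓ, c, fun i => ?_, fun i => ?_⟩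
    · rw [hℓ]; linarith [hg0 i]
    · rw [hℓ, ← hgσ i]
      constructor <;> intro h <;> linarith
  · by_contra hcon
    push Not at hcon
    obtain ⟨hz, hall⟩ := hcon
    have h1 : 0 ≤ ∑ i, z i * (w i - (ℓ (P i) + c)) := sum_nonneg fun i _ => by
      by_cases hi : z i < 0
      · rw [(heq i).2 (hall i hi)]; simp
      · exact mul_nonneg (not_lt.1 hi) (sub_nonneg.2 (hle i))
    simp only [mul_sub, sum_sub_distrib, hzaff, sub_zero] at h1
    rw [hzw] at h1
    obtain ⟨j, hj⟩ : ∃ j, z j < 0 := by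
      by_contra hnn
      push Not at hnn
      exact hz (funext fun i => (sum_eq_zero_iff_of_nonneg fun i _ => hnn i).1 hz0 i (mem_univ i))
    linarith [sum_neg (s := univ.filter fun i => z i < 0) (f := z)
      (fun i hi => (mem_filter.1 hi).2) ⟨j, by simp [hj]⟩]

include hz0 hzP in
/-- The two sides of a circuit are not both contained in simplices of a complex. -/
theorem not_neg_subset_or_not_pos_subset (hz : z ≠ 0) :
    (∀ σ : Finset ι, σ.map P ∈ T.faces → ∃ j, z j < 0 ∧ j ∉ σ) ∨
      ∀ σ : Finset ι, σ.map P ∈ T.faces → ∃ j, 0 < z j ∧ j ∉ σ := by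
  classical
  by_contra hcon
  push Not at hcon
  obtain ⟨⟨σ, hσ, hneg⟩, τ, hτ, hpos⟩ := hcon
  -- the two sides of the circuit would be disjoint simplices with a common point
  set s : ℝ := ∑ i, max (z i) 0 with hs
  have hsneg : ∑ i, max (-z i) 0 = s := by
    have : ∀ i, max (-z i) 0 = max (z i) 0 - z i := fun i => by
      rcases le_total (z i) 0 with h | h
      · rw [max_eq_left (by linarith), max_eq_right h]; ring
      · rw [max_eq_right (by linarith), max_eq_left h]; ring
    simp only [this, sum_sub_distrib, hz0, sub_zero, hs]
  have hspos : 0 < s := by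
    refine lt_of_le_of_ne (sum_nonneg fun i _ => le_max_right _ _) fun h0 => hz ?_
    have h1 := (sum_eq_zero_iff_of_nonneg fun i _ => le_max_right (z i) 0).1 h0.symm
    have h2 := (sum_eq_zero_iff_of_nonneg fun i _ => le_max_right (-z i) 0).1 (hsneg.trans h0.symm)
    funext i
    have h3 := max_eq_right_iff.1 (h1 i (mem_univ i))
    have h4 := max_eq_right_iff.1 (h2 i (mem_univ i))
    simp only [Pi.zero_apply]
    linarith
  have hxeq : ∑ i, (max (-z i) 0 / s) • P i = ∑ i, (max (z i) 0 / s) • P i := by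
    rw [← sub_eq_zero, ← sum_sub_distrib]
    have : ∀ i, (max (-z i) 0 / s) • P i - (max (z i) 0 / s) • P i = (-s⁻¹) • (z i • P i) := by
      intro i
      rw [← sub_smul, smul_smul]
      congr 1
      rcases le_total (z i) 0 with h | h
      · rw [max_eq_left (by linarith), max_eq_right h]; field_simp; ring
      · rw [max_eq_right (by linarith), max_eq_left h]; field_simp; ring
    simp only [this, ← smul_sum, hzP, smul_zero]
  have hsub : ∀ {u : ι → ℝ} {ρ : Finset ι}, (∀ i, 0 < u i → i ∈ ρ) → ρ.map P ∈ T.faces →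
      ∑ i, max (u i) 0 = s → (univ.filter fun i => 0 < u i).map P ∈ T.faces ∧
        ∑ i, (max (u i) 0 / s) • P i ∈
          convexHull ℝ (((univ.filter fun i => 0 < u i).map P : Finset E) : Set E) := by
    intro u ρ hu hρ hus
    have hne : (univ.filter fun i => 0 < u i).Nonempty := by
      by_contra hem
      rw [not_nonempty_iff_eq_empty] at hem
      have : ∀ i, max (u i) 0 = 0 := fun i => max_eq_right <| not_lt.1 fun hi => by
        have : i ∈ univ.filter fun i => 0 < u i := by simpa using hi
        simp [hem] at this
      simp only [this, sum_const_zero] at hus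
      exact hspos.ne hus
    refine ⟨T.down_closed hρ (map_subset_map.2 fun i hi => hu i (mem_filter.1 hi).2)
      (by simpa using hne), ?_⟩
    rw [coe_map]
    refine (mem_convexHull_image_iff_exists_weights _ _ _).2 ⟨_, fun i => by positivity,
      fun i hi => ?_, by rw [← sum_div, hus, div_self hspos.ne'], rfl⟩
    have : ¬ 0 < u i := by simpa using hi
    rw [max_eq_right (not_lt.1 this), zero_div]
  obtain ⟨hN, hNx⟩ := hsub (u := fun i => -z i) (fun i hi => hneg i (by linarith)) hσ hsneg
  obtain ⟨hM, hMx⟩ := hsub (u := z) hpos hτ rfl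
  have hinter := T.inter_subset_convexHull hN hM ⟨hNx, hxeq ▸ hMx⟩
  have hempty : (((univ.filter fun i => 0 < -z i).map P : Finset E) : Set E) ∩
      (((univ.filter fun i => 0 < z i).map P : Finset E) : Set E) = ∅ := by
    rw [coe_map, coe_map, ← Set.image_inter P.injective, Set.image_eq_empty]
    ext i
    simp only [coe_filter, mem_univ, true_and, Set.mem_inter_iff, Set.mem_ofPred_eq,
      Set.mem_empty_iff_false, iff_false, not_and]
    intro h1 h2
    linarith
  rw [hempty, convexHull_empty] at hinter
  exact hinter

include hz0 hzP hdep hT in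
/-- Every triangulation of a point configuration whose space of affine dependences is spanned by a
single vector `z` is regular. -/
theorem isRegularTriangulation_of_corank_le_one : IsRegularTriangulation (Set.range P) T := by
  by_cases hz : z = 0
  · refine isRegularTriangulation_of_faces_circuit P z hz0 hzP hdep T hT fun σ => ⟨fun hσ =>
      ⟨by simpa using T.nonempty_of_mem_faces hσ, Or.inl hz⟩, fun hσ => ?_⟩
    exact map_mem_faces_of_circuit P z hdep T hT (fun _ _ => Or.inl hz) σ hσ.1 hσ.2
  -- replacing `z` by `-z`, no simplex contains all points with negative coefficient
  obtain ⟨y, hy0, hyP, hydep, hsep⟩ : ∃ y : ι → ℝ, ∑ i, y i = 0 ∧ ∑ i, y i • P i = 0 ∧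
      (∀ d : ι → ℝ, ∑ i, d i = 0 → ∑ i, d i • P i = 0 → ∃ t, ∀ i, d i = t * y i) ∧
      ∀ σ : Finset ι, σ.map P ∈ T.faces → y = 0 ∨ ∃ j, y j < 0 ∧ j ∉ σ := by
    rcases not_neg_subset_or_not_pos_subset P z hz0 hzP T hz with h | h
    · exact ⟨z, hz0, hzP, hdep, fun σ hσ => Or.inr (h σ hσ)⟩
    · refine ⟨-z, by simp [hz0], by simp [hzP], fun d hd0 hdP => ?_, fun σ hσ => Or.inr ?_⟩
      · obtain ⟨t, ht⟩ := hdep d hd0 hdP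
        exact ⟨-t, fun i => by simp [ht]⟩
      · simpa using h σ hσ
  refine isRegularTriangulation_of_faces_circuit P y hy0 hyP hydep T hT fun σ => ⟨fun hσ =>
    ⟨by simpa using T.nonempty_of_mem_faces hσ, hsep σ hσ⟩, fun hσ => ?_⟩
  exact map_mem_faces_of_circuit P y hydep T hT hsep σ hσ.1 hσ.2

end CorankOne

/-! ### The vertices of the Birkhoff polytope, and the case `p < 4` -/

section PermMatrix

variable {n : Type*} [DecidableEq n]

theorem permMatrix_apply_eq_ite (π : Equiv.Perm n) (i j : n) :
    π.permMatrix ℝ i j = if π i = j then 1 else 0 := by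
  simp [Equiv.Perm.permMatrix, PEquiv.toMatrix_apply, Equiv.toPEquiv_apply]

variable (n) in
/-- The permutation matrices, as an indexed point configuration. -/
def permMatrixEmbedding : Equiv.Perm n ↪ Matrix n n ℝ where
  toFun π := π.permMatrix ℝ
  inj' π κ h := by
    ext i
    have := congrFun (congrFun h i) (κ i)
    simp only [permMatrix_apply_eq_ite, if_true] at this
    by_contra hne
    simp [hne] at this

theorem permMatrixEmbedding_apply (π : Equiv.Perm n) (i j : n) :
    permMatrixEmbedding n π i j = if π i = j then 1 else 0 :=
  permMatrix_apply_eq_ite π i j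

variable [Fintype n]

theorem sum_smul_permMatrix_apply (c : Equiv.Perm n → ℝ) (i j : n) :
    (∑ π, c π • permMatrixEmbedding n π) i j = ∑ π with π i = j, c π := by
  rw [Matrix.sum_apply, sum_filter]
  exact sum_congr rfl fun π _ => by
    rw [Matrix.smul_apply, permMatrixEmbedding_apply]; split_ifs <;> simp

end PermMatrix

theorem birkhoffVertices_eq_range (p : ℕ) :
    birkhoffVertices p = Set.range (permMatrixEmbedding (Fin p)) :=
  extremePoints_doublyStochastic

/-- If permutations are determined by the image of one index, their matrices are linearly
independent. -/
theorem isRegularTriangulation_birkhoff_of_le_two {p : ℕ} (i₀ : Fin p)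
    (h : ∀ π κ : Equiv.Perm (Fin p), π i₀ = κ i₀ → π = κ)
    (T : Geometry.SimplicialComplex ℝ (Matrix (Fin p) (Fin p) ℝ))
    (hT : IsTriangulation (birkhoffVertices p) T) :
    IsRegularTriangulation (birkhoffVertices p) T := by
  rw [birkhoffVertices_eq_range] at hT ⊢
  refine isRegularTriangulation_of_corank_le_one _ 0 (by simp) (by simp)
    (fun d _ hd => ⟨0, fun π => ?_⟩) T hT
  have := congrFun (congrFun hd i₀) (π i₀)
  rw [sum_smul_permMatrix_apply, sum_eq_single π] at this
  · simpa using this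
  · exact fun κ hκ hne => absurd (h κ π (mem_filter.1 hκ).2) hne
  · simp

/-- The six vertices of `B₃` have a one-dimensional space of dependences, spanned by the sign:
each matrix entry is covered by exactly one even and one odd permutation. -/
theorem isRegularTriangulation_birkhoff_three
    (T : Geometry.SimplicialComplex ℝ (Matrix (Fin 3) (Fin 3) ℝ))
    (hT : IsTriangulation (birkhoffVertices 3) T) :
    IsRegularTriangulation (birkhoffVertices 3) T := by
  rw [birkhoffVertices_eq_range] at hT ⊢
  have hcell : ∀ i j : Fin 3,
      ∑ π : Equiv.Perm (Fin 3) with π i = j, ((Equiv.Perm.sign π : ℤ)) = 0 := by decide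
  have hsum : ∑ π : Equiv.Perm (Fin 3), ((Equiv.Perm.sign π : ℤ)) = 0 := by decide
  have hpair : ∀ π κ : Equiv.Perm (Fin 3), Equiv.Perm.sign π ≠ Equiv.Perm.sign κ →
      ∃ i, ({ρ | ρ i = π i} : Finset (Equiv.Perm (Fin 3))) = {π, κ} := by decide
  refine isRegularTriangulation_of_corank_le_one _
    (fun π => ((Equiv.Perm.sign π : ℤ) : ℝ)) (by exact_mod_cast hsum) ?_
    (fun d _ hd => ⟨d 1, ?_⟩) T hT
  · ext i j
    rw [sum_smul_permMatrix_apply]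
    rw [Matrix.zero_apply]
    exact_mod_cast hcell i j
  · have key : ∀ π κ : Equiv.Perm (Fin 3), Equiv.Perm.sign π ≠ Equiv.Perm.sign κ →
        d π + d κ = 0 := by
      intro π κ hne
      obtain ⟨i, hi⟩ := hpair π κ hne
      have := congrFun (congrFun hd i) (π i)
      rwa [sum_smul_permMatrix_apply, hi, sum_pair (by rintro rfl; exact hne rfl)] at this
    intro π
    rcases Int.units_eq_one_or (Equiv.Perm.sign π) with hπ | hπ
    · have h1 := key π (Equiv.swap 0 1) (by rw [hπ]; decide)
      have h2 := key 1 (Equiv.swap 0 1) (by decide)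
      simp only [hπ, Units.val_one, Int.cast_one, mul_one]
      linarith
    · have h1 := key 1 π (by rw [hπ]; decide)
      simp only [hπ, Units.val_neg, Units.val_one, Int.cast_neg, Int.cast_one]
      linarith

theorem isRegularTriangulation_birkhoff_of_lt_four {p : ℕ} (hp : 0 < p) (hp4 : p < 4)
    (T : Geometry.SimplicialComplex ℝ (Matrix (Fin p) (Fin p) ℝ))
    (hT : IsTriangulation (birkhoffVertices p) T) :
    IsRegularTriangulation (birkhoffVertices p) T := by
  interval_cases p
  · exact isRegularTriangulation_birkhoff_of_le_two 0 (by decide) T hT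
  · exact isRegularTriangulation_birkhoff_of_le_two 0 (by decide) T hT
  · exact isRegularTriangulation_birkhoff_three T hT

/-! ### Triangulations of the Birkhoff polytope by pulling -/

section Pulling

variable {n : Type*}

/-- The permutations whose matrix is supported on the union of the supports of the matrices in `τ`.
These are the vertices of the smallest face of the Birkhoff polytope containing `τ`. -/
def permSpan (τ : Finset (Equiv.Perm n)) : Set (Equiv.Perm n) :=
  {π | ∀ i, ∃ ρ ∈ τ, ρ i = π i}

theorem mem_permSpan {τ : Finset (Equiv.Perm n)} {π : Equiv.Perm n} :
    π ∈ permSpan τ ↔ ∀ i, ∃ ρ ∈ τ, ρ i = π i := Iff.rfl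

theorem mem_permSpan_of_mem {τ : Finset (Equiv.Perm n)} {π : Equiv.Perm n} (h : π ∈ τ) :
    π ∈ permSpan τ := fun _ => ⟨π, h, rfl⟩

theorem permSpan_mono {σ τ : Finset (Equiv.Perm n)} (h : σ ⊆ τ) : permSpan σ ⊆ permSpan τ :=
  fun _ hπ i => let ⟨ρ, hρ, e⟩ := hπ i; ⟨ρ, h hρ, e⟩

/-- `v` is the Condorcet winner of `S`: it beats every other element of `S` under `r`. -/
def IsWinner {α : Type*} (r : α → α → Prop) (S : Set α) (v : α) : Prop :=
  v ∈ S ∧ ∀ ρ ∈ S, ρ ≠ v → r v ρ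

theorem IsWinner.unique {α : Type*} {r : α → α → Prop} (hr : ∀ a b, r a b → ¬ r b a) {S : Set α}
    {v w : α} (hv : IsWinner r S v) (hw : IsWinner r S w) : v = w := by
  by_contra hne
  exact hr _ _ (hv.2 w hw.1 (Ne.symm hne)) (hw.2 v hv.1 hne)

theorem IsWinner.mono {α : Type*} {r : α → α → Prop} {S S' : Set α} {v : α}
    (hv : IsWinner r S v) (h : S' ⊆ S) (hvS : v ∈ S') : IsWinner r S' v :=
  ⟨hvS, fun ρ hρ => hv.2 ρ (h hρ)⟩

/-- The simplices of the triangulation obtained by pulling, in every face of the Birkhoff polytope,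
the winner of that face: the winner of the smallest face containing `τ` belongs to `τ`, for every
nonempty subset `τ`. -/
def IsPulled (r : Equiv.Perm n → Equiv.Perm n → Prop) (σ : Finset (Equiv.Perm n)) : Prop :=
  ∀ τ ⊆ σ, τ.Nonempty → ∃ v ∈ τ, IsWinner r (permSpan τ) v

variable {r : Equiv.Perm n → Equiv.Perm n → Prop}

theorem IsPulled.subset {σ τ : Finset (Equiv.Perm n)} (hσ : IsPulled r σ) (h : τ ⊆ σ) :
    IsPulled r τ := fun κ hκ => hσ κ (hκ.trans h)

variable [Fintype n] [DecidableEq n]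

/-- In a pulled simplex, the winner has a matrix entry not shared with any other vertex. -/
theorem IsPulled.exists_unshared [Nonempty n] (hr : ∀ a b, r a b → ¬ r b a)
    {σ : Finset (Equiv.Perm n)} (hσ : IsPulled r σ) {v : Equiv.Perm n}
    (hv : IsWinner r (permSpan σ) v) : ∃ i, ∀ π ∈ σ, π i = v i → π = v := by
  by_contra hcon
  push Not at hcon
  have hspan : v ∈ permSpan (σ.erase v) := fun i => by
    obtain ⟨π, hπ, hi, hne⟩ := hcon i
    exact ⟨π, mem_erase.2 ⟨hne, hπ⟩, hi⟩
  have hne : (σ.erase v).Nonempty := by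
    obtain ⟨π, hπ, -⟩ := hspan (Classical.arbitrary n)
    exact ⟨π, hπ⟩
  obtain ⟨w, hw, hwin⟩ := hσ _ (erase_subset v σ) hne
  exact (mem_erase.1 hw).1
    (hwin.unique hr (hv.mono (permSpan_mono (erase_subset v σ)) hspan))

theorem mem_permSpan_iff_entries_pos {σ : Finset (Equiv.Perm n)} {c : Equiv.Perm n → ℝ}
    (hc : ∀ π, 0 ≤ c π) (hσ : ∀ π, π ∈ σ ↔ 0 < c π) {π : Equiv.Perm n} :
    π ∈ permSpan σ ↔ ∀ i, 0 < (∑ ρ, c ρ • permMatrixEmbedding n ρ) i (π i) := by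
  refine forall_congr' fun i => ?_
  rw [sum_smul_permMatrix_apply]
  constructor
  · rintro ⟨ρ, hρ, e⟩
    exact sum_pos' (fun κ _ => hc κ) ⟨ρ, by simp [e], (hσ ρ).1 hρ⟩
  · intro h
    obtain ⟨ρ, hρ, hpos⟩ := exists_ne_zero_of_sum_ne_zero h.ne'
    exact ⟨ρ, (hσ ρ).2 (lt_of_le_of_ne (hc ρ) hpos.symm), (mem_filter.1 hρ).2⟩

theorem le_entry {c : Equiv.Perm n → ℝ} (hc : ∀ π, 0 ≤ c π) (π : Equiv.Perm n) (i : n) :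
    c π ≤ (∑ ρ, c ρ • permMatrixEmbedding n ρ) i (π i) := by
  rw [sum_smul_permMatrix_apply]
  exact single_le_sum (f := c) (fun κ _ => hc κ) (by simp)

theorem IsPulled.weight_eq_entry [Nonempty n] (hr : ∀ a b, r a b → ¬ r b a)
    {σ : Finset (Equiv.Perm n)} (hσ : IsPulled r σ) {c : Equiv.Perm n → ℝ}
    (hcσ : ∀ π, π ∉ σ → c π = 0) {v : Equiv.Perm n} (hv : IsWinner r (permSpan σ) v) :
    ∃ i, (∑ ρ, c ρ • permMatrixEmbedding n ρ) i (v i) = c v := by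
  obtain ⟨i, hi⟩ := hσ.exists_unshared hr hv
  refine ⟨i, ?_⟩
  rw [sum_smul_permMatrix_apply, sum_eq_single v]
  · intro π hπ hne
    by_contra h
    exact hne (hi π (by_contra fun hπσ => h (hcσ π hπσ)) (mem_filter.1 hπ).2)
  · simp

/-- A conical combination of permutation matrices supported on a pulled simplex determines its
coefficients: the winner of the support has as coefficient the least entry on its support. -/
theorem weights_eq_of_isPulled_support [Nonempty n] (hr : ∀ a b, r a b → ¬ r b a)
    (σ τ : Finset (Equiv.Perm n)) (hσ : IsPulled r σ) (hτ : IsPulled r τ)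
    (c d : Equiv.Perm n → ℝ) (hc : ∀ π, 0 ≤ c π) (hd : ∀ π, 0 ≤ d π)
    (hcσ : ∀ π, π ∈ σ ↔ 0 < c π) (hdτ : ∀ π, π ∈ τ ↔ 0 < d π)
    (hcd : ∑ π, c π • permMatrixEmbedding n π = ∑ π, d π • permMatrixEmbedding n π) : c = d := by
  induction hk : #σ generalizing σ τ c d with
  | zero =>
    rw [card_eq_zero] at hk
    subst hk
    have hc0 : c = 0 := funext fun π =>
      le_antisymm (not_lt.1 fun h => by simpa using (hcσ π).2 h) (hc π)
    subst hc0
    funext π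
    have := le_entry hd π (Classical.arbitrary n)
    rw [← hcd] at this
    simp only [Pi.zero_apply, zero_smul, sum_const_zero, Matrix.zero_apply] at this
    exact (le_antisymm this (hd π)).symm
  | succ k ih =>
    have hσne : σ.Nonempty := card_pos.1 (by omega)
    have hspan : permSpan σ = permSpan τ := by
      ext π
      rw [mem_permSpan_iff_entries_pos hc hcσ, mem_permSpan_iff_entries_pos hd hdτ, hcd]
    obtain ⟨v, hv, hwin⟩ := hσ σ Subset.rfl hσne
    have hwin' : IsWinner r (permSpan τ) v := hspan ▸ hwin
    have hcv : ∀ π, π ∉ σ → c π = 0 := fun π h =>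
      le_antisymm (not_lt.1 fun h' => h ((hcσ π).2 h')) (hc π)
    have hdv : ∀ π, π ∉ τ → d π = 0 := fun π h =>
      le_antisymm (not_lt.1 fun h' => h ((hdτ π).2 h')) (hd π)
    obtain ⟨i, hi⟩ := hσ.weight_eq_entry hr hcv hwin
    obtain ⟨j, hj⟩ := hτ.weight_eq_entry hr hdv hwin'
    have hvv : c v = d v := by
      apply le_antisymm
      · rw [← hj, ← hcd]; exact le_entry hc v j
      · rw [← hi, hcd]; exact le_entry hd v i
    have hupd : ∀ (e : Equiv.Perm n → ℝ),
        ∑ π, Function.update e v 0 π • permMatrixEmbedding n π =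
          ∑ π, e π • permMatrixEmbedding n π - e v • permMatrixEmbedding n v := by
      intro e
      rw [← add_sum_erase _ _ (mem_univ v), ← add_sum_erase univ (fun π => e π • _) (mem_univ v)]
      simp only [Function.update_self, zero_smul, zero_add, add_sub_cancel_left]
      exact sum_congr rfl fun π hπ => by rw [Function.update_of_ne (mem_erase.1 hπ).1]
    have hpos : ∀ (e : Equiv.Perm n → ℝ) (κ : Finset (Equiv.Perm n)), (∀ π, π ∈ κ ↔ 0 < e π) →
        ∀ π, π ∈ κ.erase v ↔ 0 < Function.update e v 0 π := by
      intro e κ h π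
      by_cases hπ : π = v
      · subst hπ; simp
      · simp [hπ, h]
    have hnn : ∀ (e : Equiv.Perm n → ℝ), (∀ π, 0 ≤ e π) →
        ∀ π, 0 ≤ Function.update e v 0 π := by
      intro e h π
      by_cases hπ : π = v
      · subst hπ; simp
      · simp [hπ, h]
    have := ih (σ.erase v) (τ.erase v) (hσ.subset (erase_subset _ _))
      (hτ.subset (erase_subset _ _)) (Function.update c v 0) (Function.update d v 0)
      (hnn c hc) (hnn d hd) (hpos c σ hcσ) (hpos d τ hdτ) (by rw [hupd, hupd, hcd, hvv])
      (by rw [card_erase_of_mem hv, hk, Nat.add_sub_cancel])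
    funext π
    by_cases hπ : π = v
    · rw [hπ, hvv]
    · simpa [hπ] using congrFun this π

theorem weights_eq_of_isPulled [Nonempty n] (hr : ∀ a b, r a b → ¬ r b a)
    {σ τ : Finset (Equiv.Perm n)} (hσ : IsPulled r σ) (hτ : IsPulled r τ)
    {c d : Equiv.Perm n → ℝ} (hc : ∀ π, 0 ≤ c π) (hd : ∀ π, 0 ≤ d π)
    (hcσ : ∀ π, π ∉ σ → c π = 0) (hdτ : ∀ π, π ∉ τ → d π = 0)
    (hcd : ∑ π, c π • permMatrixEmbedding n π = ∑ π, d π • permMatrixEmbedding n π) : c = d := by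
  have hsub : ∀ {e : Equiv.Perm n → ℝ} {κ : Finset (Equiv.Perm n)}, (∀ π, π ∉ κ → e π = 0) →
      (univ.filter fun π => 0 < e π) ⊆ κ := fun h π hπ =>
    by_contra fun hκ => (mem_filter.1 hπ).2.ne' (h π hκ)
  exact weights_eq_of_isPulled_support hr _ _ (hσ.subset (hsub hcσ)) (hτ.subset (hsub hdτ)) c d
    hc hd (by simp) (by simp) hcd

/-- Greedy decomposition: subtracting from a matrix the largest possible multiple of the winner of
its support, and iterating, writes it as a conical combination supported on a pulled simplex. -/
theorem exists_isPulled_weights [Nonempty n]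
    (hwin : ∀ τ : Finset (Equiv.Perm n), τ.Nonempty → ∃ v, IsWinner r (permSpan τ) v)
    (M : Matrix n n ℝ) (s : ℝ) (hs : 0 ≤ s) (hM : ∃ M' ∈ doublyStochastic ℝ n, M = s • M') :
    ∃ (σ : Finset (Equiv.Perm n)) (c : Equiv.Perm n → ℝ), IsPulled r σ ∧ (∀ π, 0 ≤ c π) ∧
      (∀ π, π ∈ σ ↔ 0 < c π) ∧ ∑ π, c π • permMatrixEmbedding n π = M := by
  induction hd : #{q : n × n | M q.1 q.2 ≠ 0} using Nat.strong_induction_on generalizing M s with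
  | _ d ih =>
  rcases hs.eq_or_lt with rfl | hs'
  · obtain ⟨M', -, rfl⟩ := hM
    exact ⟨∅, 0, fun τ hτ hne => absurd (subset_empty.1 hτ) hne.ne_empty, by simp, by simp, by simp⟩
  obtain ⟨M', hM', hMM'⟩ := id hM
  obtain ⟨w, hw0, hw1, hwM⟩ := exists_eq_sum_perm_of_mem_doublyStochastic hM'
  have hwM2 : ∑ π, (s * w π) • permMatrixEmbedding n π = M := by
    rw [hMM', ← hwM, smul_sum]
    exact sum_congr rfl fun π _ => mul_smul _ _ _
  have hτne : (univ.filter fun π => 0 < s * w π).Nonempty := by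
    obtain ⟨π, -, hπ⟩ := exists_ne_zero_of_sum_ne_zero (hw1.trans_ne one_ne_zero)
    exact ⟨π, by simpa using mul_pos hs' (lt_of_le_of_ne (hw0 π) hπ.symm)⟩
  have hspan : ∀ π, π ∈ permSpan (univ.filter fun π => 0 < s * w π) ↔ ∀ i, 0 < M i (π i) := by
    intro π
    rw [mem_permSpan_iff_entries_pos (c := fun π => s * w π)
      (fun π => mul_nonneg hs (hw0 π)) (by simp), hwM2]
  obtain ⟨v, hv, hvwin⟩ := hwin _ hτne
  rw [hspan] at hv
  obtain ⟨i₀, -, hi₀⟩ := exists_min_image univ (fun i => M i (v i)) univ_nonempty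
  set t := M i₀ (v i₀) with ht
  rw [exists_mem_doublyStochastic_eq_smul_iff hs] at hM
  set N : Matrix n n ℝ := M - t • permMatrixEmbedding n v with hN
  have hNapp : ∀ i j, N i j = M i j - if v i = j then t else 0 := fun i j => by
    rw [hN, Matrix.sub_apply, Matrix.smul_apply, permMatrixEmbedding_apply]
    split_ifs <;> simp
  have hts : t ≤ s := by
    rw [← hM.2.1 i₀]
    exact single_le_sum (f := fun j => M i₀ j) (fun j _ => hM.1 i₀ j) (mem_univ _)
  have hNst : ∃ N' ∈ doublyStochastic ℝ n, N = (s - t) • N' := by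
    rw [exists_mem_doublyStochastic_eq_smul_iff (sub_nonneg.2 hts)]
    refine ⟨fun i j => ?_, fun i => ?_, fun j => ?_⟩
    · rw [hNapp]
      split_ifs with h
      · subst h; exact sub_nonneg.2 (hi₀ i (mem_univ i))
      · simpa using hM.1 i j
    · simp only [hNapp, sum_sub_distrib, hM.2.1 i, sum_ite_eq, mem_univ, if_true]
    · simp only [hNapp, sum_sub_distrib, hM.2.2 j, ← v.eq_symm_apply, sum_ite_eq', mem_univ,
        if_true]
  have hNM : ∀ i j, N i j ≤ M i j := fun i j => by
    rw [hNapp]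
    split_ifs
    · linarith [hv i₀]
    · simp
  have hNnn : ∀ i j, 0 ≤ N i j :=
    ((exists_mem_doublyStochastic_eq_smul_iff (sub_nonneg.2 hts)).1 hNst).1
  have hcard : #{q : n × n | N q.1 q.2 ≠ 0} < d := by
    rw [← hd]
    refine card_lt_card ((ssubset_iff_of_subset ?_).2 ⟨(i₀, v i₀), ?_, ?_⟩)
    · intro q hq
      simp only [mem_filter, mem_univ, true_and] at hq ⊢
      intro h0
      exact hq (le_antisymm (h0 ▸ hNM _ _) (hNnn _ _))
    · simpa using (hv i₀).ne'
    · simp [hNapp, ht]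
  obtain ⟨σ, c, hσ, hc0, hcσ, hcN⟩ := ih _ hcard N (s - t) (sub_nonneg.2 hts) hNst rfl
  have hσM : ∀ π ∈ insert v σ, ∀ i, 0 < M i (π i) := by
    intro π hπ
    rcases mem_insert.1 hπ with rfl | hπ
    · exact hv
    · intro i
      have := le_entry hc0 π i
      rw [hcN] at this
      exact ((hcσ π).1 hπ).trans_le (this.trans (hNM _ _))
  refine ⟨insert v σ, fun π => c π + if π = v then t else 0, fun τ hτ hne => ?_, fun π => ?_,
    fun π => ?_, ?_⟩
  · by_cases hvτ : v ∈ τ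
    · refine ⟨v, hvτ, mem_permSpan_of_mem hvτ, fun ρ hρ hne => hvwin ρ ?_ hne⟩
      rw [hspan]
      intro i
      obtain ⟨π, hπ, e⟩ := hρ i
      rw [← e]
      exact hσM π (hτ hπ) i
    · exact hσ τ (fun π hπ => (mem_insert.1 (hτ hπ)).resolve_left
        (by rintro rfl; exact hvτ hπ)) hne
  · have := hc0 π
    have := hv i₀
    dsimp only
    split_ifs <;> linarith
  · rw [mem_insert, hcσ]
    by_cases h : π = v
    · subst h
      have := hc0 π
      have := hv i₀
      simp only [true_or, if_true, true_iff]
      linarith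
    · simp [h]
  · simp only [add_smul, sum_add_distrib, hcN, ite_smul, zero_smul, sum_ite_eq', mem_univ, if_true,
      hN, sub_add_cancel]

theorem affineIndependent_of_isPulled [Nonempty n] (hr : ∀ a b, r a b → ¬ r b a)
    {σ : Finset (Equiv.Perm n)} (hσ : IsPulled r σ) :
    AffineIndependent ℝ ((↑) : (σ.map (permMatrixEmbedding n) : Finset _) → Matrix n n ℝ) := by
  have hlin : LinearIndepOn ℝ (permMatrixEmbedding n) (σ : Set (Equiv.Perm n)) := by
    rw [linearIndepOn_finset_iff]
    intro f hf π hπ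
    -- compare the positive and the negative part of the dependence
    have key := weights_eq_of_isPulled hr hσ hσ
      (c := fun π => if π ∈ σ then max (f π) 0 else 0)
      (d := fun π => if π ∈ σ then max (-f π) 0 else 0)
      (fun π => by split_ifs <;> simp) (fun π => by split_ifs <;> simp)
      (fun π h => if_neg h) (fun π h => if_neg h) (by
        rw [← sub_eq_zero, ← sum_sub_distrib, ← hf]
        refine (sum_subset (subset_univ σ) fun π _ h => by simp [h]).symm.trans
          (sum_congr rfl fun π h => ?_)
        rw [if_pos h, if_pos h, ← sub_smul]
        congr 1
        rcases le_total (f π) 0 with h | h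
        · rw [max_eq_right h, max_eq_left (by linarith)]; ring
        · rw [max_eq_left h, max_eq_right (by linarith)]; ring)
    have := congrFun key π
    simp only [hπ, if_true] at this
    rcases le_total (f π) 0 with h | h
    · rw [max_eq_right h, max_eq_left (by linarith)] at this; linarith
    · rw [max_eq_left h, max_eq_right (by linarith)] at this; linarith
  have hid : LinearIndepOn ℝ id
      ((σ.map (permMatrixEmbedding n) : Finset _) : Set (Matrix n n ℝ)) := by
    rw [coe_map]; exact hlin.id_image
  exact LinearIndependent.affineIndependent ℝ hid

/-- The triangulation of the Birkhoff polytope obtained by pulling the winner in every face. -/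
def pulledTriangulation [Nonempty n] (r : Equiv.Perm n → Equiv.Perm n → Prop)
    (hr : ∀ a b, r a b → ¬ r b a) : Geometry.SimplicialComplex ℝ (Matrix n n ℝ) where
  faces := {s | ∃ σ : Finset (Equiv.Perm n), σ.Nonempty ∧ IsPulled r σ ∧
    s = σ.map (permMatrixEmbedding n)}
  isRelLowerSet_faces := by
    rintro _ ⟨σ, hne, hσ, rfl⟩
    refine ⟨by simpa using hne, fun t ht htne => ?_⟩
    obtain ⟨τ, hτ, rfl⟩ := subset_map_iff.1 ht
    exact ⟨τ, by simpa using htne, hσ.subset hτ, rfl⟩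
  indep := by
    rintro _ ⟨σ, -, hσ, rfl⟩
    exact affineIndependent_of_isPulled hr hσ
  inter_subset_convexHull := by
    rintro _ _ ⟨σ, -, hσ, rfl⟩ ⟨τ, -, hτ, rfl⟩ x ⟨hx, hx'⟩
    rw [coe_map] at hx hx'
    obtain ⟨c, hc0, hcσ, hc1, hcx⟩ := (mem_convexHull_image_iff_exists_weights _ _ _).1 hx
    obtain ⟨d, hd0, hdτ, hd1, hdx⟩ := (mem_convexHull_image_iff_exists_weights _ _ _).1 hx'
    have hcd := weights_eq_of_isPulled hr hσ hτ hc0 hd0 (by simpa using hcσ) (by simpa using hdτ)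
      (hcx.trans hdx.symm)
    subst hcd
    rw [coe_map, coe_map, ← Set.image_inter (permMatrixEmbedding n).injective]
    refine (mem_convexHull_image_iff_exists_weights _ _ _).2 ⟨c, hc0, fun π hπ => ?_, hc1, hcx⟩
    by_contra h
    exact hπ ⟨by_contra fun h' => h (hcσ π h'), by_contra fun h' => h (hdτ π h')⟩

theorem mem_faces_pulledTriangulation [Nonempty n] (hr : ∀ a b, r a b → ¬ r b a)
    {σ : Finset (Equiv.Perm n)} : σ.map (permMatrixEmbedding n) ∈ (pulledTriangulation r hr).faces ↔
      σ.Nonempty ∧ IsPulled r σ := by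
  constructor
  · rintro ⟨τ, hne, hτ, h⟩
    rw [map_inj] at h
    subst h
    exact ⟨hne, hτ⟩
  · rintro ⟨hne, hσ⟩
    exact ⟨σ, hne, hσ, rfl⟩

end Pulling

theorem isTriangulation_pulledTriangulation {p : ℕ} [Nonempty (Fin p)]
    {r : Equiv.Perm (Fin p) → Equiv.Perm (Fin p) → Prop} (hr : ∀ a b, r a b → ¬ r b a)
    (hwin : ∀ τ : Finset (Equiv.Perm (Fin p)), τ.Nonempty → ∃ v, IsWinner r (permSpan τ) v) :
    IsTriangulation (birkhoffVertices p) (pulledTriangulation r hr) := by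
  rw [birkhoffVertices_eq_range]
  have hsub : ∀ σ : Finset (Equiv.Perm (Fin p)),
      ((σ.map (permMatrixEmbedding (Fin p)) : Finset _) : Set (Matrix (Fin p) (Fin p) ℝ)) ⊆
        Set.range (permMatrixEmbedding (Fin p)) := fun σ => by
    rw [coe_map]; exact Set.image_subset_range _ _
  refine ⟨?_, Set.Subset.antisymm ?_ ?_⟩
  · rw [Geometry.SimplicialComplex.vertices_eq]
    refine Set.iUnion₂_subset ?_
    rintro _ ⟨σ, -, -, rfl⟩
    exact hsub σ
  · refine Set.iUnion₂_subset ?_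
    rintro _ ⟨σ, -, -, rfl⟩
    exact convexHull_mono (hsub σ)
  · intro x hx
    have hxD : x ∈ doublyStochastic ℝ (Fin p) := by
      rw [← SetLike.mem_coe, doublyStochastic_eq_convexHull_permMatrix]; exact hx
    obtain ⟨σ, c, hσ, hc0, hcσ, hcx⟩ :=
      exists_isPulled_weights hwin x 1 zero_le_one ⟨x, hxD, (one_smul _ _).symm⟩
    have hc1 : ∑ π, c π = 1 := by
      have := sum_row_of_mem_doublyStochastic hxD (Classical.arbitrary (Fin p))
      rw [← hcx] at this
      simp only [sum_smul_permMatrix_apply] at this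
      rw [← this]
      exact (sum_fiberwise univ (fun π : Equiv.Perm (Fin p) => π (Classical.arbitrary _)) c).symm
    have hne : σ.Nonempty := by
      obtain ⟨π, -, hπ⟩ := exists_ne_zero_of_sum_ne_zero (hc1.trans_ne one_ne_zero)
      exact ⟨π, (hcσ π).2 (lt_of_le_of_ne (hc0 π) hπ.symm)⟩
    refine Geometry.SimplicialComplex.mem_space_iff.2
      ⟨_, (mem_faces_pulledTriangulation hr).2 ⟨hne, hσ⟩, ?_⟩
    rw [coe_map]
    refine (mem_convexHull_image_iff_exists_weights _ _ _).2 ⟨c, hc0, fun π hπ => ?_, hc1, hcx⟩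
    exact le_antisymm (not_lt.1 fun h => hπ ((hcσ π).2 h)) (hc0 π)

/-! ### A cyclic pulling relation with non-regular triangulation -/

/-- If a triangulation of points in convex position is regular with heights `w`, then an equality
of sums of points, one side of which lies in a simplex `σ` and the other does not, turns into a
strict inequality of the heights. -/
theorem IsRegularTriangulation.exists_heights_sum_lt {E : Type*} [AddCommGroup E] [Module ℝ E]
    {ι : Type*} [Fintype ι] (P : ι ↪ E) {T : Geometry.SimplicialComplex ℝ E}
    (hT : IsRegularTriangulation (Set.range P) T)
    (hP : ∀ i, P i ∈ Set.extremePoints ℝ (convexHull ℝ (Set.range P))) :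
    ∃ w : ι → ℝ, ∀ σ : Finset ι, σ.map P ∈ T.faces → ∀ {κ : Type} [Fintype κ] (a b : κ → ι),
      (∀ k, a k ∈ σ) → (∃ k, b k ∉ σ) → ∑ k, P (a k) = ∑ k, P (b k) →
        ∑ k, w (a k) < ∑ k, w (b k) := by
  obtain ⟨-, w, hw⟩ := hT
  refine ⟨fun i => w (P i), fun σ hσ κ _ a b ha ⟨k₀, hk₀⟩ hab => ?_⟩
  obtain ⟨F, ⟨-, ξ, hξ, rfl⟩, hF⟩ := hw.subset ⟨σ.map P, hσ, rfl⟩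
  obtain ⟨i₀, -, hi₀⟩ := exists_max_image univ (fun i => ξ (P i, w (P i))) ⟨a k₀, mem_univ _⟩
  set m := ξ (P i₀, w (P i₀)) with hm
  rw [image_fst_maximal_face P w ξ m (fun i => hi₀ i (mem_univ i)) ⟨i₀, rfl⟩, coe_map] at hF
  -- as the points are extreme, the lower face contains no further lifted points
  have hext : ∀ (S : Set ι) (i : ι), P i ∈ convexHull ℝ (P '' S) → i ∈ S := by
    intro S i hi
    have := extremePoints_convexHull_subset
      (inter_extremePoints_subset_extremePoints_of_subset
        (convexHull_mono (Set.image_subset_range P S)) ⟨hi, hP i⟩)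
    exact (P.injective.mem_set_image).1 this
  have hmem : ∀ i, i ∈ σ ↔ ξ (P i, w (P i)) = m := by
    intro i
    constructor
    · intro hi
      refine hext {i | ξ (P i, w (P i)) = m} i (hF ▸ subset_convexHull ℝ _ ⟨i, hi, rfl⟩)
    · intro hi
      exact hext (σ : Set ι) i (hF.symm ▸ subset_convexHull ℝ _ ⟨i, hi, rfl⟩)
  have hlt : ∑ k, ξ (P (b k), w (P (b k))) < ∑ k, ξ (P (a k), w (P (a k))) := by
    refine sum_lt_sum (fun k _ => ?_) ⟨k₀, mem_univ _, ?_⟩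
    · rw [(hmem _).1 (ha k)]; exact hi₀ _ (mem_univ _)
    · rw [(hmem _).1 (ha k₀)]
      exact lt_of_le_of_ne (hi₀ _ (mem_univ _)) fun h => hk₀ ((hmem _).2 h)
  have hsplit : ∀ c : κ → ι, ∑ k, ξ (P (c k), w (P (c k))) =
      ξ (∑ k, P (c k), 0) + (∑ k, w (P (c k))) * ξ (0, 1) := fun c => by
    rw [← map_sum, ← smul_eq_mul, ← map_smul, ← map_add]
    congr 1
    ext <;> simp [Prod.fst_sum, Prod.snd_sum]
  rw [hsplit, hsplit, hab] at hlt
  have := lt_of_add_lt_add_left hlt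
  exact (mul_lt_mul_right_of_neg hξ).1 this

/-- Elements of a finite type can be ranked with prescribed first elements. -/
theorem exists_injective_rank {α : Type*} [Finite α] {k : ℕ} (g : Fin k → α)
    (hg : Function.Injective g) :
    ∃ rank : α → ℕ, Function.Injective rank ∧ ∀ i, rank (g i) = i := by
  classical
  obtain ⟨m, ⟨e⟩⟩ := Finite.exists_equiv_fin α
  refine ⟨fun x => if h : ∃ i, g i = x then (h.choose : ℕ) else k + e x, fun x y hxy => ?_,
    fun i => ?_⟩
  · dsimp only at hxy
    split_ifs at hxy with hx hy hy
    · rw [← hx.choose_spec, ← hy.choose_spec, Fin.ext hxy]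
    · have := hx.choose.2; omega
    · have := hy.choose.2; omega
    · exact e.injective (Fin.ext (by omega))
  · have h : ∃ j, g j = g i := ⟨i, rfl⟩
    dsimp only
    rw [dif_pos h, hg h.choose_spec]

section Cyclic

variable {n : Type*} [DecidableEq n]

theorem viaFintypeEmbedding_injective (f : Fin 4 ↪ n) :
    Function.Injective fun π : Equiv.Perm (Fin 4) => π.viaFintypeEmbedding f := by
  intro π κ h
  ext i
  have := DFunLike.congr_fun h (f i)
  simp only [Equiv.Perm.viaFintypeEmbedding_apply_image] at this
  rw [f.injective this]

/-- Dependences between `4 × 4` permutation matrices persist after bordering by an identity. -/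
theorem sum_permMatrix_viaFintypeEmbedding_eq (f : Fin 4 ↪ n) (a b : Fin 3 → Equiv.Perm (Fin 4))
    (h : ∀ i j, #{k | a k i = j} = #{k | b k i = j}) :
    ∑ k, permMatrixEmbedding n ((a k).viaFintypeEmbedding f) =
      ∑ k, permMatrixEmbedding n ((b k).viaFintypeEmbedding f) := by
  ext i j
  simp only [Matrix.sum_apply, permMatrixEmbedding_apply]
  by_cases hi : i ∈ Set.range f
  · obtain ⟨i, rfl⟩ := hi
    simp only [Equiv.Perm.viaFintypeEmbedding_apply_image]
    by_cases hj : j ∈ Set.range f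
    · obtain ⟨j, rfl⟩ := hj
      simp only [f.injective.eq_iff, sum_boole, h]
    · have : ∀ x, f x ≠ j := fun x hx => hj ⟨x, hx⟩
      simp [this]
  · simp only [Equiv.Perm.viaFintypeEmbedding_apply_notMem_range _ _ hi]

variable [Fintype n]

/-- Outside of the embedded four indices all permutations in question fix every point. -/
theorem viaFintypeEmbedding_mem_permSpan_iff (f : Fin 4 ↪ n) (σ : Finset (Equiv.Perm (Fin 4)))
    (hσ : σ.Nonempty) (π : Equiv.Perm (Fin 4)) :
    π.viaFintypeEmbedding f ∈ permSpan (σ.image fun ρ => ρ.viaFintypeEmbedding f) ↔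
      π ∈ permSpan σ := by
  constructor
  · intro h i
    obtain ⟨ρ, hρ, e⟩ := h (f i)
    obtain ⟨ρ, hρ', rfl⟩ := mem_image.1 hρ
    rw [Equiv.Perm.viaFintypeEmbedding_apply_image, Equiv.Perm.viaFintypeEmbedding_apply_image] at e
    exact ⟨ρ, hρ', f.injective e⟩
  · intro h i
    by_cases hi : i ∈ Set.range f
    · obtain ⟨i, rfl⟩ := hi
      obtain ⟨ρ, hρ, e⟩ := h i
      refine ⟨_, mem_image_of_mem _ hρ, ?_⟩
      rw [Equiv.Perm.viaFintypeEmbedding_apply_image, Equiv.Perm.viaFintypeEmbedding_apply_image, e]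
    · obtain ⟨ρ, hρ⟩ := hσ
      refine ⟨_, mem_image_of_mem _ hρ, ?_⟩
      rw [Equiv.Perm.viaFintypeEmbedding_apply_notMem_range _ _ hi,
        Equiv.Perm.viaFintypeEmbedding_apply_notMem_range _ _ hi]

/-- The linear order on ranks, except that rank `3` beats rank `1`. -/
def CyclicBeats (i j : ℕ) : Prop := (i < j ∧ ¬ (i = 1 ∧ j = 3)) ∨ (i = 3 ∧ j = 1)

theorem CyclicBeats.asymm (i j : ℕ) (h : CyclicBeats i j) : ¬ CyclicBeats j i := by
  unfold CyclicBeats at *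
  omega

/-- The permutations of ranks `0, …, 6`: the identity, the transpositions `(0 2)`, `(1 2)`, `(0 1)`,
and one endpoint of each of the three edges of the polytope that occur in the dependences. Each
permutation is given by its values and those of its inverse. -/
def topPerm : Fin 7 → Equiv.Perm (Fin 4) :=
  ![1,
    ⟨![2, 1, 0, 3], ![2, 1, 0, 3], by decide, by decide⟩,
    ⟨![0, 2, 1, 3], ![0, 2, 1, 3], by decide, by decide⟩,
    ⟨![1, 0, 2, 3], ![1, 0, 2, 3], by decide, by decide⟩,
    ⟨![1, 0, 3, 2], ![1, 0, 3, 2], by decide, by decide⟩,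
    ⟨![0, 2, 3, 1], ![0, 3, 1, 2], by decide, by decide⟩,
    ⟨![2, 0, 3, 1], ![1, 3, 0, 2], by decide, by decide⟩]

/-- The other endpoints of the three edges starting at `topPerm 4`, `topPerm 5`, `topPerm 6`. -/
def edgePerm : Fin 3 → Equiv.Perm (Fin 4) :=
  ![⟨![3, 0, 2, 1], ![1, 3, 2, 0], by decide, by decide⟩,
    ⟨![3, 0, 1, 2], ![1, 2, 3, 0], by decide, by decide⟩,
    ⟨![3, 1, 0, 2], ![2, 1, 3, 0], by decide, by decide⟩]

theorem topPerm_injective : Function.Injective topPerm := by decide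

/-- A triple is a simplex if its first vertex wins the triple and its second vertex wins the edge
to the third one. -/
theorem isPulled_triple {r : Equiv.Perm n → Equiv.Perm n → Prop} {u v w : Equiv.Perm n}
    (hu : ∀ ρ ∈ permSpan {u, v, w}, ρ ≠ u → r u ρ) (hv : ∀ ρ ∈ permSpan {v, w}, ρ ≠ v → r v ρ) :
    IsPulled r {u, v, w} := by
  intro τ hτ hne
  by_cases hut : u ∈ τ
  · exact ⟨u, hut, mem_permSpan_of_mem hut, fun ρ hρ => hu ρ (permSpan_mono hτ hρ)⟩
  have hτ' : τ ⊆ {v, w} := fun x hx =>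
    (mem_insert.1 (hτ hx)).resolve_left (by rintro rfl; exact hut hx)
  by_cases hvt : v ∈ τ
  · exact ⟨v, hvt, mem_permSpan_of_mem hvt, fun ρ hρ => hv ρ (permSpan_mono hτ' hρ)⟩
  have hτw : τ ⊆ {w} := fun x hx =>
    (mem_insert.1 (hτ' hx)).resolve_left (by rintro rfl; exact hvt hx)
  have hw : τ = {w} := (subset_singleton_iff.1 hτw).resolve_left hne.ne_empty
  subst hw
  refine ⟨w, mem_singleton_self w, mem_permSpan_of_mem (mem_singleton_self w), fun ρ hρ hne => ?_⟩
  refine absurd (Equiv.ext fun i => ?_) hne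
  obtain ⟨κ, hκ, e⟩ := hρ i
  rw [← e, mem_singleton.1 hκ]

variable (f : Fin 4 ↪ n) (rank : Equiv.Perm n → ℕ) (hinj : Function.Injective rank)
  (hrank : ∀ i, rank ((topPerm i).viaFintypeEmbedding f) = i)

include hinj hrank in
/-- The cycle of the three transpositions is harmless: a face containing all three of them also
contains the identity, which beats everything. -/
theorem exists_isWinner_cyclic (τ : Finset (Equiv.Perm n)) (hτ : τ.Nonempty) :
    ∃ v, IsWinner (fun π ρ => CyclicBeats (rank π) (rank ρ)) (permSpan τ) v := by
  have hex : ∃ k, ∃ π ∈ permSpan τ, rank π = k :=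
    ⟨_, hτ.choose, mem_permSpan_of_mem hτ.choose_spec, rfl⟩
  classical
  obtain ⟨v, hv, hvk⟩ := Nat.find_spec hex
  have hmin : ∀ ρ ∈ permSpan τ, rank v ≤ rank ρ := fun ρ hρ =>
    hvk ▸ Nat.find_min' hex ⟨ρ, hρ, rfl⟩
  have htop : ∀ (i : Fin 7) (ρ : Equiv.Perm n), rank ρ = i →
      ρ = (topPerm i).viaFintypeEmbedding f := fun i ρ h => hinj (h.trans (hrank i).symm)
  by_cases h1 : rank v = 1 ∧ (topPerm 3).viaFintypeEmbedding f ∈ permSpan τ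
  · obtain ⟨h1, h3⟩ := h1
    refine ⟨_, h3, fun ρ hρ hne => ?_⟩
    have hle := hmin ρ hρ
    have hρ3 : rank ρ ≠ 3 := fun h => hne (htop 3 ρ h)
    have hρ2 : rank ρ ≠ 2 := by
      intro h
      rw [htop 2 ρ h] at hρ
      rw [htop 1 v h1] at hv
      have hid : (topPerm 0).viaFintypeEmbedding f ∈ permSpan τ := by
        have : (topPerm 0).viaFintypeEmbedding f ∈ permSpan
            (({topPerm 1, topPerm 2, topPerm 3} : Finset _).image
              fun ρ => ρ.viaFintypeEmbedding f) := by
          rw [viaFintypeEmbedding_mem_permSpan_iff _ _ (by simp), mem_permSpan]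
          decide
        intro i
        obtain ⟨κ, hκ, e⟩ := this i
        rw [← e]
        simp only [image_insert, image_singleton, mem_insert, mem_singleton] at hκ
        rcases hκ with rfl | rfl | rfl
        exacts [hv i, hρ i, h3 i]
      have := hmin _ hid
      rw [hrank, h1] at this
      simp at this
    dsimp only
    rw [hrank, show ((3 : Fin 7) : ℕ) = 3 from rfl]
    unfold CyclicBeats
    omega
  · refine ⟨v, hv, fun ρ hρ hne => ?_⟩
    have hle := hmin ρ hρ
    have hne' : rank ρ ≠ rank v := fun h => hne (hinj h)
    have h13 : ¬ (rank v = 1 ∧ rank ρ = 3) := fun h => h1 ⟨h.1, htop 3 ρ h.2 ▸ hρ⟩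
    unfold CyclicBeats
    omega

include hinj hrank in
/-- To see that the permutation of rank `i` beats everything in a face, it suffices to check the
seven permutations of lowest rank. -/
theorem cyclicBeats_of_topPerm_notMem {σ : Finset (Equiv.Perm (Fin 4))} (hσ : σ.Nonempty)
    (i : Fin 7) (h : ∀ j, j ≠ i → ¬ CyclicBeats i j → topPerm j ∉ permSpan σ)
    (ρ : Equiv.Perm n) (hρ : ρ ∈ permSpan (σ.image fun ρ => ρ.viaFintypeEmbedding f))
    (hne : ρ ≠ (topPerm i).viaFintypeEmbedding f) :
    CyclicBeats (rank ((topPerm i).viaFintypeEmbedding f)) (rank ρ) := by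
  rw [hrank]
  by_cases hj : rank ρ < 7
  · have hρj : ρ = (topPerm ⟨rank ρ, hj⟩).viaFintypeEmbedding f := hinj (hrank ⟨_, hj⟩).symm
    by_contra hcon
    refine h ⟨rank ρ, hj⟩ (fun e => hne (e ▸ hρj)) hcon ?_
    rw [hρj, viaFintypeEmbedding_mem_permSpan_iff _ _ hσ] at hρ
    exact hρ
  · have := i.2
    unfold CyclicBeats
    omega

instance : DecidableRel CyclicBeats := fun i j => by unfold CyclicBeats; infer_instance

include hinj hrank in
theorem isPulled_cyclic (i j : Fin 7) (k : Fin 3)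
    (hi : ∀ l, l ≠ i → ¬ CyclicBeats i l →
      topPerm l ∉ permSpan {topPerm i, topPerm j, edgePerm k})
    (hj : ∀ l, l ≠ j → ¬ CyclicBeats j l → topPerm l ∉ permSpan {topPerm j, edgePerm k}) :
    IsPulled (fun π ρ => CyclicBeats (rank π) (rank ρ))
      {(topPerm i).viaFintypeEmbedding f, (topPerm j).viaFintypeEmbedding f,
        (edgePerm k).viaFintypeEmbedding f} := by
  refine isPulled_triple (fun ρ hρ => ?_) (fun ρ hρ => ?_)
  · exact cyclicBeats_of_topPerm_notMem f rank hinj hrank (by simp) i hi ρ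
      (by simpa only [image_insert, image_singleton] using hρ)
  · exact cyclicBeats_of_topPerm_notMem f rank hinj hrank (by simp) j hj ρ
      (by simpa only [image_insert, image_singleton] using hρ)

end Cyclic

theorem exists_not_isRegularTriangulation_birkhoff {p : ℕ} (hp : 4 ≤ p) :
    ∃ T : Geometry.SimplicialComplex ℝ (Matrix (Fin p) (Fin p) ℝ),
      IsTriangulation (birkhoffVertices p) T ∧
        ¬ IsRegularTriangulation (birkhoffVertices p) T := by
  have : Nonempty (Fin p) := ⟨⟨0, by omega⟩⟩
  let f : Fin 4 ↪ Fin p := Fin.castLEEmb hp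
  obtain ⟨rank, hinj, hrank⟩ := exists_injective_rank
    (fun i => (topPerm i).viaFintypeEmbedding f)
    ((viaFintypeEmbedding_injective f).comp topPerm_injective)
  have hr : ∀ π ρ : Equiv.Perm (Fin p), CyclicBeats (rank π) (rank ρ) →
    ¬ CyclicBeats (rank ρ) (rank π) := fun _ _ => CyclicBeats.asymm _ _
  refine ⟨pulledTriangulation _ hr, isTriangulation_pulledTriangulation hr
    (exists_isWinner_cyclic f rank hinj hrank), fun hreg => ?_⟩
  rw [birkhoffVertices_eq_range] at hreg
  obtain ⟨w, hw⟩ := hreg.exists_heights_sum_lt (permMatrixEmbedding (Fin p)) fun π => by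
    have h : (doublyStochastic ℝ (Fin p) : Set (Matrix (Fin p) (Fin p) ℝ)) =
      convexHull ℝ (Set.range (permMatrixEmbedding (Fin p))) :=
        doublyStochastic_eq_convexHull_permMatrix
    rw [← h, extremePoints_doublyStochastic]
    exact ⟨π, rfl⟩
  -- each dependence exchanges a pulled simplex for a triple with a vertex outside of it
  have key : ∀ (i j i' j' : Fin 7) (k k' : Fin 3),
      (∀ l, l ≠ i → ¬ CyclicBeats i l →
        topPerm l ∉ permSpan {topPerm i, topPerm j, edgePerm k}) →
      (∀ l, l ≠ j → ¬ CyclicBeats j l → topPerm l ∉ permSpan {topPerm j, edgePerm k}) →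
      topPerm i' ∉ ({topPerm i, topPerm j, edgePerm k} : Finset _) →
      (∀ x y, #{s | ![topPerm i, topPerm j, edgePerm k] s x = y} =
        #{s | ![topPerm i', topPerm j', edgePerm k'] s x = y}) →
      w ((topPerm i).viaFintypeEmbedding f) + w ((topPerm j).viaFintypeEmbedding f) +
          w ((edgePerm k).viaFintypeEmbedding f) <
        w ((topPerm i').viaFintypeEmbedding f) + w ((topPerm j').viaFintypeEmbedding f) +
          w ((edgePerm k').viaFintypeEmbedding f) := by
    intro i j i' j' k k' hi hj hnot hsum
    have := hw _ ((mem_faces_pulledTriangulation hr).2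
      ⟨by simp, isPulled_cyclic f rank hinj hrank i j k hi hj⟩)
      (fun s => (![topPerm i, topPerm j, edgePerm k] s).viaFintypeEmbedding f)
      (fun s => (![topPerm i', topPerm j', edgePerm k'] s).viaFintypeEmbedding f)
      (by simp [Fin.forall_fin_succ])
      ⟨0, by
        simp only [mem_insert, mem_singleton] at hnot ⊢
        simpa only [Matrix.cons_val_zero, (viaFintypeEmbedding_injective f).eq_iff] using hnot⟩
      (sum_permMatrix_viaFintypeEmbedding_eq f _ _ hsum)
    simpa [Fin.sum_univ_three] using this
  -- with `a, b, c` the transpositions and `X, Y, Z` the sums of the endpoints of the three edges: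
  -- `b + X = c + Y`, `a + Y = b + Z` and `c + Z = a + X`
  have h1 := key 2 4 3 5 0 1 (by simp only [mem_permSpan]; decide)
    (by simp only [mem_permSpan]; decide) (by decide) (by decide)
  have h2 := key 1 5 2 6 1 2 (by simp only [mem_permSpan]; decide)
    (by simp only [mem_permSpan]; decide) (by decide) (by decide)
  have h3 := key 3 6 1 4 2 0 (by simp only [mem_permSpan]; decide)
    (by simp only [mem_permSpan]; decide) (by decide) (by decide)
  linarith

end

theorem mainTheorem6 (p : ℕ) (hp : 0 < p) :
    (4 ≤ p → ∃ T : Geometry.SimplicialComplex ℝ (Matrix (Fin p) (Fin p) ℝ),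
      IsTriangulation (birkhoffVertices p) T ∧
        ¬ IsRegularTriangulation (birkhoffVertices p) T) ∧
    (p < 4 → ∀ T : Geometry.SimplicialComplex ℝ (Matrix (Fin p) (Fin p) ℝ),
      IsTriangulation (birkhoffVertices p) T →
        IsRegularTriangulation (birkhoffVertices p) T) :=
  ⟨exists_not_isRegularTriangulation_birkhoff, isRegularTriangulation_birkhoff_of_lt_four hp⟩
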